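/- Let $\mathbf C$ be an adhesive category with all pullbacks, with a strict initial object $\emptyset$, in which every morphism has an epi-mono factorization. **Derivations.** A rule is a span of monomorphisms $p=(L\xleftarrow{l}K\xrightarrow{r}R)$. A direct derivation $G\Rightarrow_p H$ consists of a match $g\colon L\to G$, an intermediate object $Z$, and morphisms $z\colon K\to Z$, $h\colon R\to H$, $m_{Z\to G}\colon Z\to G$, $m_{Z\to H}\colon Z\to H$ such that the squares $L\leftarrow K\to Z$, $L\to G\leftarrow Z$ and $R\leftarrow K\to Z$, $R\to H\leftarrow Z$ are pushouts. For a set $P$ of rules, a $P$-derivation $G\Rightarrow_P^* X$ is a finite (possibly empty) sequence of direct derivations by rules of $P$. A pair $(P,\overline P)$ of sets of rules is parallel independent if for any direct derivations $G\Rightarrow_p H$ and $G\Rightarrow_{\overline p}\overline H$ with $p\in P$, $\overline p\in\overline P$, with matches $g,\overline g$ and intermediate objects $Z,\overline Z$, the match $g$ factors through $m_{\overline Z\to G}$ and $\overline g$ factors through $m_{Z\to G}$. **Restriction.** Let $m\colon G'\to G$ be a monomorphism. A direct derivation $G'\Rightarrow_p H'$ (with $g',z',h'$ and intermediate object $Z'$)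 is the restriction of $G\Rightarrow_p H$ with respect to $m$, with induced morphism $n\colon H'\to H$, if there is $m_Z\colon Z'\to Z$ with $m g'=g$, $m_Z z'=z$, $n h'=h$ such that $Z'$ is the pullback of $m$ and $m_{Z\to G}$ and also the pullback of $n$ and $m_{Z\to H}$ (via $m_Z$ and the structure morphisms of $Z'$). The restriction $d|m$ of a derivation $d$ is obtained by restricting the first step with respect to $m$ and then the remaining derivation with respect to $n$; for length $0$ it is the derivation of length $0$ from $G'$. It is determined up to isomorphism. Two derivations $d$, from $G$, and $d'$, from $G'$, are equal up to isomorphism, $d\equiv d'$, if $d'=d|\iota$ for some isomorphism $\iota\colon G'\to G$. **Accessed part and spine.** The accessed part of $d=(G\Rightarrow_P^*X)$ is the monomorphism $\mathrm{acc}(d)\colon \mathrm{ACC}(d)\to G$ given by $\emptyset\to G$ for length $0$, and by $\mathrm{ACC}(d)=g(L)\cup(Z\cap \mathrm{ACC}(\hat d))$ if $d$ consists of $G\Rightarrow_p H$ followed by $\hat d$; here $g(L)$ is the image of $g$ in its epi-mono factorization, $Z\cap\mathrm{ACC}(\hat d)$ is the pullback of $m_{Z\to H}$ and $\mathrm{acc}(\hat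 d)$, viewed over $G$ via $m_{Z\to G}$, and the union of two monomorphisms into $G$ is the pushout of their pullback with its mediating morphism to $G$. The spine of $d$ is $\mathrm{spine}(d)=d|\mathrm{acc}(d)$. **Moving.** Let $G\Rightarrow_p H$ (intermediate object $Z$) and $G\Rightarrow_{\overline p}G'$ (intermediate object $\overline Z$) be parallel independent. Let $\hat Z$ be the pullback of $Z$ and $\overline Z$ over $G$, let $\overline Z\Rightarrow_p\overline Z'$ be the restriction of the first step to $\overline Z$ and $Z\Rightarrow_{\overline p}Z'$ the restriction of the second step to $Z$, both with intermediate object $\hat Z$, and let $H'$ be the pushout of $\overline Z'\leftarrow\hat Z\to Z'$. Pasting squares yields direct derivations $G'\Rightarrow_p H'$ with intermediate object $Z'$ and $H\Rightarrow_{\overline p}H'$ with intermediate object $\overline Z'$ (the conflux of the two steps). For a $P$-derivation $d=(G\Rightarrow^*_PX)$ and a direct derivation $\overline d=(G\Rightarrow_{\overline p}G')$, $\overline p\in\overline P$, the moved derivation $\mathrm{move}(d,\overline d)=(G'\Rightarrow_P^*X')$ is obtained by iterating conflux along $d$: it is the derivation of length $0$ from $G'$ if $d$ has length $0$, and otherwise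 the step $G'\Rightarrow_pH'$ followed by $\mathrm{move}(\hat d,\,H\Rightarrow_{\overline p}H')$, where $d$ is $G\Rightarrow_pH$ followed by $\hat d$. It is determined up to isomorphism. **Lemma.** Let $(P,\overline P)$ be a parallel independent pair of sets of rules, let $d=(G\Rightarrow_P^*X)$ be a derivation, and let $\overline d=(G\Rightarrow_{\overline p}G')$ be a direct derivation with $\overline p\in\overline P$, with intermediate object $\overline Z$ and morphisms $m_{\overline Z\to G}$ and $m_{\overline Z\to G'}$. Then $d'=\mathrm{move}(d,\overline d)$ exists, and every choice of it satisfies: 1. There is a derivation $d''=(\overline Z\Rightarrow_P^*Z'')$, for some object $Z''$, such that $d|m_{\overline Z\to G}=d''=d'|m_{\overline Z\to G'}$. 2. There are an isomorphism $i\colon\mathrm{ACC}(d)\to\mathrm{ACC}(d')$ and monomorphisms $m\colon\mathrm{ACC}(d)\to\overline Z$ and $m'\colon\mathrm{ACC}(d')\to\overline Z$ such that $m'\circ i=m$, $m_{\overline Z\to G}\circ m=\mathrm{acc}(d)$ and $m_{\overline Z\to G'}\circ m'=\mathrm{acc}(d')$. 3. The spines of $d$ and $d'$ exist, and $\mathrm{spine}(d)\equiv\mathrm{spine}(d')$.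 -/

import Mathlib

open CategoryTheory CategoryTheory.Limits

universe v u

namespace DPO

/-- A rule: a span of monomorphisms `L ← K → R`. -/
structure Rule (C : Type u) [Category.{v} C] where
  L : C
  K : C
  R : C
  l : K ⟶ L
  r : K ⟶ R
  mono_l : Mono l
  mono_r : Mono r

attribute [instance] Rule.mono_l Rule.mono_r

/-- A direct derivation `G ⟹ H` by the rule `p`: a double pushout with left matching morphism `g`,
intermediate object `Z` (with morphisms `mG : Z ⟶ G` and `mH : Z ⟶ H`) and right matching
morphism `h`. -/
structure DirectDerivation {C : Type u} [Category.{v} C] (p : Rule C) (G H : C) where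
  Z : C
  g : p.L ⟶ G
  z : p.K ⟶ Z
  h : p.R ⟶ H
  mG : Z ⟶ G
  mH : Z ⟶ H
  left : IsPushout p.l z g mG
  right : IsPushout p.r z h mH

/-- A `P`-derivation `G ⟹* X`: a finite sequence of direct derivations by rules of `P`. -/
inductive Deriv {C : Type u} [Category.{v} C] (P : Set (Rule C)) : C → C → Type (max u v)
  | nil (G : C) : Deriv P G G
  | cons {G H X : C} (p : Rule C) (hp : p ∈ P) (s : DirectDerivation p G H)
      (t : Deriv P H X) : Deriv P G X

/-- `(P, P')` is parallel independent: any `P`-step and any `P'`-step from the same object are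
parallel independent, that is, each match factors through the intermediate object of the other. -/
def ParallelIndependent {C : Type u} [Category.{v} C] (P P' : Set (Rule C)) : Prop :=
  ∀ p ∈ P, ∀ p' ∈ P', ∀ (G H H' : C) (s : DirectDerivation p G H) (s' : DirectDerivation p' G H'),
    (∃ f : p.L ⟶ s'.Z, f ≫ s'.mG = s.g) ∧ (∃ f' : p'.L ⟶ s.Z, f' ≫ s.mG = s'.g)

section Conflux

variable {C : Type u} [Category.{v} C]

/-- The diagrams of the local Church-Rosser construction (conflux), starting from
`s : G ⟹ H` by `p` and `t : G ⟹ G'` by `q`, and resulting in `s' : G' ⟹ H'` by `p` and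
`t' : H ⟹ H'` by `q`. Here `t.Z ⟹ t'.Z` is the restriction of `s` to the intermediate object `t.Z`,
`s.Z ⟹ s'.Z` is the restriction of `t` to `s.Z`, both with intermediate object `W`
(the pullback of `s.Z` and `t.Z` over `G`), and `H'` is the pushout of `t'.Z` and `s'.Z`
over `W`. -/
structure Conflux {p q : Rule C} {G H G' H' : C}
    (s : DirectDerivation p G H) (t : DirectDerivation q G G')
    (s' : DirectDerivation p G' H') (t' : DirectDerivation q H H') where
  W : C
  toZs : W ⟶ s.Z
  toZt : W ⟶ t.Z
  toZs' : W ⟶ s'.Z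
  toZt' : W ⟶ t'.Z
  /-- the double pushout `t.Z ⟹ t'.Z` -/
  f : p.L ⟶ t.Z
  k : p.K ⟶ W
  f' : p.R ⟶ t'.Z
  left_p : IsPushout p.l k f toZt
  right_p : IsPushout p.r k f' toZt'
  /-- the double pushout `s.Z ⟹ s'.Z` -/
  e : q.L ⟶ s.Z
  j : q.K ⟶ W
  e' : q.R ⟶ s'.Z
  left_q : IsPushout q.l j e toZs
  right_q : IsPushout q.r j e' toZs'
  /-- the squares relating the four intermediate objects and the four derived objects -/
  sq_G : IsPullback toZs toZt s.mG t.mG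
  sq_H : IsPullback toZs toZt' s.mH t'.mG
  sq_G' : IsPullback toZs' toZt s'.mG t.mH
  sq_H' : IsPushout toZs' toZt' s'.mH t'.mH
  /-- `s` and `t` are the given double pushouts -/
  s_g : f ≫ t.mG = s.g
  s_z : k ≫ toZs = s.z
  s_h : f' ≫ t'.mG = s.h
  t_g : e ≫ s.mG = t.g
  t_z : j ≫ toZt = t.z
  t_h : e' ≫ s'.mG = t.h
  /-- `s'` and `t'` are the composed double pushouts -/
  s'_g : f ≫ t.mH = s'.g
  s'_z : k ≫ toZs' = s'.z
  s'_h : f' ≫ t'.mH = s'.h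
  t'_g : e ≫ s.mH = t'.g
  t'_z : j ≫ toZt' = t'.z
  t'_h : e' ≫ s'.mH = t'.h

end Conflux

/-- `IsMove d t d' t'`: moving the derivation `d : G ⟹* X` along the direct derivation
`t : G ⟹ G'` by iterated conflux yields the derivation `d' : G' ⟹* X'`, and moving `t` along `d`
yields `t' : X ⟹ X'`. Conflux is determined only up to isomorphism, so this is a relation. -/
inductive IsMove {C : Type u} [Category.{v} C] {P : Set (Rule C)} {q : Rule C} :
    {G X G' X' : C} → Deriv P G X → DirectDerivation q G G' →
      Deriv P G' X' → DirectDerivation q X X' → Prop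
  | nil {G G' : C} (t : DirectDerivation q G G') :
      IsMove (Deriv.nil G) t (Deriv.nil G') t
  | cons {G H X G' H' X' : C} {p : Rule C} (hp : p ∈ P)
      {s : DirectDerivation p G H} {t : DirectDerivation q G G'}
      {s' : DirectDerivation p G' H'} {t' : DirectDerivation q H H'}
      {d : Deriv P H X} {d' : Deriv P H' X'} {t'' : DirectDerivation q X X'}
      (c : Conflux s t s' t') (h : IsMove d t' d' t'') :
      IsMove (Deriv.cons p hp s d) t (Deriv.cons p hp s' d') t''

/-- `s' : G' ⟹ H'` is the single-step restriction of `s : G ⟹ H` with respect to the monomorphism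
`m : G' ⟶ G`, and `n : H' ⟶ H` is the resulting morphism between the derived objects. -/
structure IsStepRestriction {C : Type u} [Category.{v} C] {p : Rule C} {G H G' H' : C}
    (m : G' ⟶ G) (n : H' ⟶ H) (s : DirectDerivation p G H) (s' : DirectDerivation p G' H') :
    Prop where
  mono : Mono m
  comp_g : s'.g ≫ m = s.g
  comp_h : s'.h ≫ n = s.h
  exists_mZ : ∃ mZ : s'.Z ⟶ s.Z, s'.z ≫ mZ = s.z ∧
    IsPullback mZ s'.mG s.mG m ∧ IsPullback mZ s'.mH s.mH n

/-- `IsRestriction m d d'`: the derivation `d' : G' ⟹* X'` is a restriction of `d : G ⟹* X` with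
respect to the monomorphism `m : G' ⟶ G` (determined only up to isomorphism by `m` and `d`). -/
inductive IsRestriction {C : Type u} [Category.{v} C] {P : Set (Rule C)} :
    {G X G' X' : C} → (G' ⟶ G) → Deriv P G X → Deriv P G' X' → Prop
  | nil {G G' : C} (m : G' ⟶ G) (hm : Mono m) :
      IsRestriction m (Deriv.nil G) (Deriv.nil G')
  | cons {G H X G' H' X' : C} {m : G' ⟶ G} {n : H' ⟶ H} {p : Rule C} (hp : p ∈ P)
      {s : DirectDerivation p G H} {s' : DirectDerivation p G' H'}
      {d : Deriv P H X} {d' : Deriv P H' X'}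
      (hs : IsStepRestriction m n s s') (hd : IsRestriction n d d') :
      IsRestriction m (Deriv.cons p hp s d) (Deriv.cons p hp s' d')

/-- Equality of derivations up to isomorphism: one is the restriction of the other along an
isomorphism of the start objects. -/
def EqUpToIso {C : Type u} [Category.{v} C] {P : Set (Rule C)} {G X G' X' : C}
    (d : Deriv P G X) (d' : Deriv P G' X') : Prop :=
  ∃ i : G' ≅ G, IsRestriction i.hom d d'

section Accessed

variable {C : Type u} [Category.{v} C]

/-- The image `g(L) ⟶ G` of an epi-mono factorization of `g : L ⟶ G`. -/
noncomputable def img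
    [(MorphismProperty.epimorphisms C).HasFactorization (MorphismProperty.monomorphisms C)]
    {L G : C} (g : L ⟶ G) : MonoOver G :=
  haveI : Mono (MorphismProperty.factorizationData
      (MorphismProperty.epimorphisms C) (MorphismProperty.monomorphisms C) g).p :=
    (MorphismProperty.factorizationData _ _ g).hp
  MonoOver.mk (MorphismProperty.factorizationData
      (MorphismProperty.epimorphisms C) (MorphismProperty.monomorphisms C) g).p

/-- The union of two monomorphisms `a : A ⟶ G` and `b : B ⟶ G`: the mediating morphism into `G` from
the pushout of their pullback. -/
noncomputable def union [Adhesive C] {A B G : C} (a : A ⟶ G) (b : B ⟶ G) [Mono a] [Mono b] :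
    MonoOver G :=
  MonoOver.mk (pushout.desc (f := pullback.fst a b) (g := pullback.snd a b) a b pullback.condition)

variable [Adhesive C] [HasPullbacks C] [HasInitial C] [HasStrictInitialObjects C]
  [(MorphismProperty.epimorphisms C).HasFactorization (MorphismProperty.monomorphisms C)]
  {P : Set (Rule C)}

/-- The accessed part of a derivation as a monomorphism into its start object: `∅` for length `0`,
and `g(L) ∪ (Z ∩ ACC (tail d))` otherwise. -/
noncomputable def Deriv.accessed : {G X : C} → Deriv P G X → MonoOver G
  | _, _, .nil G => MonoOver.mk (initial.to G)
  | _, _, .cons _ _ s t =>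
    haveI : Mono s.mG := Adhesive.mono_of_isPushout_of_mono_left s.left
    union (img s.g).arrow (pullback.fst s.mH (t.accessed).arrow ≫ s.mG)

/-- The domain of the accessed part. -/
noncomputable def Deriv.ACC {G X : C} (d : Deriv P G X) : C := (d.accessed).obj.left

/-- The accessed part as a morphism. -/
noncomputable def Deriv.acc {G X : C} (d : Deriv P G X) : d.ACC ⟶ G :=
  (d.accessed).arrow

/-- `s` is a spine of `d`: a restriction of `d` to its accessed part. -/
def IsSpine {G X S : C} (d : Deriv P G X) (s : Deriv P d.ACC S) : Prop :=
  IsRestriction d.acc d s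

end Accessed

end DPO

open DPO

/-! Conflux already contains a step `t.Z ⟹ t'.Z` that restricts both `s` and `s'`; chaining these
along `d` gives a common restriction `d''` (`IsMove.exists_common_restriction`). Accessed parts are
compared by universal property: `acc` of a nonempty derivation is the least subobject containing the
first match and the part of the tail's accessed part lying in `Z` (`exists_factor_acc_cons_iff`).
Tested against subobjects of `t.Z`, this condition reads the same for `d` and `d'`, so both accessed
parts are one subobject of `t.Z` (`IsMove.exists_acc_iso`). By `IsRestriction.cancel` both spines
are then restrictions of `d''` along isomorphic subobjects, hence restrictions of each other. That
spines exist is a van Kampen argument (`exists_isRestriction`). -/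

namespace DPO

/-! ### Pushouts cut down to subobjects -/

section Squares

variable {C : Type u} [Category.{v} C]

lemma isPullback_id_of_comp_mono {A B D : C} {f : A ⟶ B} {m : B ⟶ D} {g : A ⟶ D} [Mono m]
    (h : f ≫ m = g) : IsPullback f (𝟙 A) m g :=
  IsPullback.of_isLimit' ⟨by simpa using h⟩ <|
    PullbackCone.IsLimit.mk _ (fun c => c.snd)
      (fun c => by rw [← cancel_mono m, Category.assoc, h, c.condition])
      (fun c => by simp)
      (fun c k _ hk => by simpa using hk)

lemma mono_fst_of_isPullback {A B D E : C} {x : A ⟶ B} {y : A ⟶ D} {f : B ⟶ E} {g : D ⟶ E}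
    [Mono g] (h : IsPullback x y f g) : Mono x :=
  MorphismProperty.of_isPullback (P := MorphismProperty.monomorphisms C) h.flip ‹Mono g›

variable [Adhesive C]

/-- Pulling back a pushout along a monomorphism through which one of its legs factors. -/
lemma isPushout_restrict {K L Z G G' Z' : C} {l : K ⟶ L} {z : K ⟶ Z} {g : L ⟶ G} {mG : Z ⟶ G}
    [Mono l] (H : IsPushout l z g mG) {n : G' ⟶ G} [Mono n] {mZ : Z' ⟶ Z} {mG' : Z' ⟶ G'}
    (hZ : IsPullback mZ mG' mG n) {f : L ⟶ G'} (hf : f ≫ n = g) {z' : K ⟶ Z'}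
    (hz : z' ≫ mZ = z) (hz' : z' ≫ mG' = l ≫ f) : IsPushout l z' f mG' := by
  have : Mono mZ := mono_fst_of_isPullback hZ
  -- Van Kampen cube over `H`: all four side faces are pullbacks, those with an identity vertical
  -- because `mZ` and `n` are monic, so the top face is a pushout.
  exact (Adhesive.van_kampen H l z' f mG' (𝟙 K) (𝟙 L) mZ n
    (IsPullback.of_vert_isIso ⟨by simp⟩) (isPullback_id_of_comp_mono hz)
    ⟨by simpa using hf⟩ hZ.flip.toCommSq ⟨hz'.symm⟩).2
    ⟨isPullback_id_of_comp_mono hf, hZ.flip⟩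

/-- A morphism into a pushout factors through a monomorphism `n` as soon as one leg of the pushout
and the part of the morphism over the other leg do. -/
lemma exists_factor_of_isPushout {K R Z H N A B : C} {r : K ⟶ R} {z : K ⟶ Z} {h : R ⟶ H}
    {mH : Z ⟶ H} [Mono r] (sq : IsPushout r z h mH) (n : N ⟶ H) [Mono n] (a : A ⟶ H) [Mono a]
    {x : B ⟶ Z} {y : B ⟶ A} (hB : IsPullback x y mH a)
    (hh : ∃ u, u ≫ n = h) (hx : ∃ u, u ≫ n = x ≫ mH) : ∃ u, u ≫ n = a := by
  obtain ⟨u, hu⟩ := hh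
  obtain ⟨w, hw⟩ := hx
  have hR := IsPullback.of_hasPullback a h
  have : HasPullback (pullback.snd a h) r := hasPullback_symmetry _ _
  -- Pulling the pushout back along `a` exhibits `A` as a pushout of its parts over `R` and `Z`, so
  -- a factorization through `n` can be glued from these two.
  obtain ⟨W', f', g', αW, _, _, top⟩ :=
    (Adhesive.van_kampen sq).exists_cube_filling hR hB.flip
  have e : f' ≫ pullback.snd a h ≫ u = g' ≫ w := by
    rw [← cancel_mono n]
    simp only [Category.assoc, hu, hw, hB.w, ← hR.w, top.w_assoc]
  refine ⟨top.desc (pullback.snd a h ≫ u) w e, top.hom_ext ?_ ?_⟩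
  · simp only [top.inl_desc_assoc, Category.assoc, hu, hR.w]
  · simp only [top.inr_desc_assoc, hw, hB.w]

end Squares

/-! ### Restriction of steps and derivations -/

section Restriction

variable {C : Type u} [Category.{v} C] [Adhesive C] {p : Rule C}

lemma DirectDerivation.mono_mG {G H : C} (s : DirectDerivation p G H) : Mono s.mG :=
  Adhesive.mono_of_isPushout_of_mono_left s.left

lemma DirectDerivation.mono_mH {G H : C} (s : DirectDerivation p G H) : Mono s.mH :=
  Adhesive.mono_of_isPushout_of_mono_left s.right

/-- Cancelling the right square of `s'` from that of `s` leaves a pushout in which `n` is opposite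
the monomorphism `mZ`. This lets restriction continue along the tail. -/
lemma IsStepRestriction.mono_induced {G H G' H' : C} {m : G' ⟶ G} {n : H' ⟶ H}
    {s : DirectDerivation p G H} {s' : DirectDerivation p G' H'}
    (hs : IsStepRestriction m n s s') : Mono n := by
  obtain ⟨mZ, hz, hG, hH⟩ := hs.exists_mZ
  have := hs.mono
  have : Mono mZ := mono_fst_of_isPullback hG
  have sq : IsPushout p.r (s'.z ≫ mZ) (s'.h ≫ n) s.mH := by
    rw [hz, hs.comp_h]; exact s.right
  exact Adhesive.mono_of_isPushout_of_mono_right (sq.of_top hH.w.symm s'.right)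

/-- A direct derivation restricts along every monomorphism through which its match factors. -/
lemma exists_isStepRestriction {G H G' : C} (s : DirectDerivation p G H) (m : G' ⟶ G) [Mono m]
    (hg : ∃ u, u ≫ m = s.g) :
    ∃ (H' : C) (n : H' ⟶ H) (s' : DirectDerivation p G' H'), IsStepRestriction m n s s' := by
  obtain ⟨f, hf⟩ := hg
  have := s.mono_mG
  have hZ := IsPullback.of_hasPullback s.mG m
  have : Mono (pullback.fst s.mG m) := mono_fst_of_isPullback hZ
  have e : s.z ≫ s.mG = (p.l ≫ f) ≫ m := by rw [Category.assoc, hf, s.left.w]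
  have hz : hZ.lift s.z (p.l ≫ f) e ≫ pullback.fst s.mG m = s.z := hZ.lift_fst _ _ _
  have left := isPushout_restrict s.left hZ hf hz (hZ.lift_snd _ _ _)
  have right := IsPushout.of_hasPushout p.r (hZ.lift s.z (p.l ≫ f) e)
  have w : p.r ≫ s.h = hZ.lift s.z (p.l ≫ f) e ≫ pullback.fst s.mG m ≫ s.mH := by
    rw [reassoc_of% hz, s.right.w]
  -- Van Kampen in the other direction: the top is a pushout by construction, so the faces over `H`
  -- are pullbacks.
  have faces := (Adhesive.van_kampen s.right p.r _ _ _ (𝟙 _) (𝟙 _) (pullback.fst s.mG m)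
    (right.desc s.h (pullback.fst s.mG m ≫ s.mH) w)
    (IsPullback.of_vert_isIso ⟨by simp⟩) (isPullback_id_of_comp_mono hz)
    ⟨by simp⟩ ⟨by simp⟩ right.toCommSq).1 right
  exact ⟨_, right.desc s.h (pullback.fst s.mG m ≫ s.mH) w,
    ⟨_, f, _, _, _, _, left, right⟩, ‹Mono m›, hf, right.inl_desc _ _ _,
    pullback.fst s.mG m, hz, hZ, faces.2.flip⟩

/-- The comparison of intermediate objects comes from the pullback `s₂.Z`, that of results from the
pushout `H₁`; both required squares then follow by pullback cancellation. -/
lemma IsStepRestriction.cancel {G G₁ G₂ H H₁ H₂ : C} {a : G₁ ⟶ G₂} {b : G₂ ⟶ G}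
    {n₁ : H₁ ⟶ H} {n₂ : H₂ ⟶ H} {s : DirectDerivation p G H} {s₁ : DirectDerivation p G₁ H₁}
    {s₂ : DirectDerivation p G₂ H₂} (h₁ : IsStepRestriction (a ≫ b) n₁ s s₁)
    (h₂ : IsStepRestriction b n₂ s s₂) :
    ∃ n : H₁ ⟶ H₂, n ≫ n₂ = n₁ ∧ IsStepRestriction a n s₂ s₁ := by
  have hn₂ := h₂.mono_induced
  have hb := h₂.mono
  have hab := h₁.mono
  obtain ⟨x₁, hz₁, hG₁, hH₁⟩ := h₁.exists_mZ
  obtain ⟨x₂, hz₂, hG₂, hH₂⟩ := h₂.exists_mZ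
  have hx₂ : Mono x₂ := mono_fst_of_isPullback hG₂
  have e : x₁ ≫ s.mG = (s₁.mG ≫ a) ≫ b := by rw [hG₁.w, Category.assoc]
  have hx : hG₂.lift x₁ (s₁.mG ≫ a) e ≫ x₂ = x₁ := hG₂.lift_fst _ _ _
  have hy : hG₂.lift x₁ (s₁.mG ≫ a) e ≫ s₂.mG = s₁.mG ≫ a := hG₂.lift_snd _ _ _
  generalize hG₂.lift x₁ (s₁.mG ≫ a) e = x at hx hy
  have hz : s₁.z ≫ x = s₂.z := by
    rw [← cancel_mono x₂, Category.assoc, hx, hz₁, hz₂]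
  have w : p.r ≫ s₂.h = s₁.z ≫ x ≫ s₂.mH := by rw [reassoc_of% hz, s₂.right.w]
  have hn : s₁.right.desc s₂.h (x ≫ s₂.mH) w ≫ n₂ = n₁ := by
    apply s₁.right.hom_ext
    · rw [s₁.right.inl_desc_assoc, h₁.comp_h, h₂.comp_h]
    · rw [s₁.right.inr_desc_assoc, Category.assoc, ← hH₂.w, reassoc_of% hx, hH₁.w]
  refine ⟨_, hn, mono_of_mono a b, ?_, s₁.right.inl_desc _ _ _, x, hz, ?_, ?_⟩
  · rw [← cancel_mono b, Category.assoc, h₁.comp_g, h₂.comp_g]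
  · rw [← hx] at hG₁
    exact hG₁.flip.of_bot hy.symm hG₂.flip |>.flip
  · rw [← hx, ← hn] at hH₁
    exact hH₁.flip.of_bot (s₁.right.inr_desc _ _ _) hH₂.flip |>.flip

/-- If `d|(a ≫ b)` and `d|b` are given, then the former is the restriction of the latter. -/
lemma IsRestriction.cancel {P : Set (Rule C)} {G X G₁ X₁ G₂ X₂ : C} {d : Deriv P G X}
    {d₁ : Deriv P G₁ X₁} {d₂ : Deriv P G₂ X₂} {a : G₁ ⟶ G₂} {b : G₂ ⟶ G}
    (h₁ : IsRestriction (a ≫ b) d d₁) (h₂ : IsRestriction b d d₂) : IsRestriction a d₂ d₁ := by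
  generalize hc : a ≫ b = c at h₁
  induction h₂ generalizing G₁ X₁ with
  | nil b hb =>
    cases h₁ with
    | nil _ hm => subst hc; exact .nil a (mono_of_mono a b)
  | cons hp hs hd ih =>
    cases h₁ with
    | cons _ hs₁ hd₁ =>
      subst hc
      obtain ⟨n, hn, hs'⟩ := hs₁.cancel hs
      exact .cons hp hs' (ih _ hn hd₁)

end Restriction

/-! ### Accessed parts as least subobjects -/

section Accessed

variable {C : Type u} [Category.{v} C] [Adhesive C]

lemma exists_factor_union_iff {A B G N : C} (a : A ⟶ G) (b : B ⟶ G) [Mono a] [Mono b]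
    (n : N ⟶ G) [Mono n] :
    (∃ u, u ≫ n = (union a b).arrow) ↔ (∃ u, u ≫ n = a) ∧ ∃ u, u ≫ n = b := by
  change (∃ u : pushout (pullback.fst a b) (pullback.snd a b) ⟶ N,
    u ≫ n = pushout.desc a b pullback.condition) ↔ _
  constructor
  · rintro ⟨u, hu⟩
    exact ⟨⟨pushout.inl _ _ ≫ u, by rw [Category.assoc, hu, pushout.inl_desc]⟩,
      ⟨pushout.inr _ _ ≫ u, by rw [Category.assoc, hu, pushout.inr_desc]⟩⟩
  · rintro ⟨⟨u, hu⟩, w, hw⟩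
    refine ⟨pushout.desc u w ?_, pushout.hom_ext ?_ ?_⟩
    · rw [← cancel_mono n, Category.assoc, Category.assoc, hu, hw, pullback.condition]
    · rw [pushout.inl_desc_assoc, hu, pushout.inl_desc]
    · rw [pushout.inr_desc_assoc, hw, pushout.inr_desc]

variable [(MorphismProperty.epimorphisms C).HasFactorization (MorphismProperty.monomorphisms C)]

/-- Monomorphisms in an adhesive category are strong, so the epi part of the factorization lifts
against `n`. -/
lemma exists_factor_img_iff {L G N : C} (g : L ⟶ G) (n : N ⟶ G) [Mono n] :
    (∃ u, u ≫ n = (img g).arrow) ↔ ∃ u, u ≫ n = g := by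
  let D := MorphismProperty.factorizationData
    (MorphismProperty.epimorphisms C) (MorphismProperty.monomorphisms C) g
  change (∃ u : D.Z ⟶ N, u ≫ n = D.p) ↔ _
  constructor
  · rintro ⟨u, hu⟩
    exact ⟨D.i ≫ u, by rw [Category.assoc, hu, D.fac]⟩
  · rintro ⟨u, hu⟩
    have : Epi D.i := D.hi
    have : StrongMono n := strongMono_of_mono n
    have sq : CommSq u D.i n D.p := ⟨by rw [hu, D.fac]⟩
    exact ⟨sq.lift, sq.fac_right⟩

variable [HasPullbacks C] [HasInitial C] [HasStrictInitialObjects C] {P : Set (Rule C)}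

instance Deriv.mono_acc {G X : C} (d : Deriv P G X) : Mono d.acc :=
  inferInstanceAs (Mono d.accessed.arrow)

/-- The accessed part of a nonempty derivation is the least monomorphism through which the match of
the first step and the accessed part of the tail, seen through the intermediate object, factor. -/
lemma exists_factor_acc_cons_iff {G H X N B : C} {p : Rule C} (hp : p ∈ P)
    (s : DirectDerivation p G H) (t : Deriv P H X) {x : B ⟶ s.Z} {y : B ⟶ t.ACC}
    (hB : IsPullback x y s.mH t.acc) (n : N ⟶ G) [Mono n] :
    (∃ u, u ≫ n = (Deriv.cons p hp s t).acc) ↔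
      (∃ u, u ≫ n = s.g) ∧ ∃ u, u ≫ n = x ≫ s.mG := by
  have := s.mono_mG
  rw [← exists_factor_img_iff s.g]
  refine (exists_factor_union_iff (img s.g).arrow (pullback.fst s.mH t.acc ≫ s.mG) n).trans
    (and_congr_right fun _ => ?_)
  constructor
  · rintro ⟨u, hu⟩
    exact ⟨hB.isoPullback.hom ≫ u, by rw [Category.assoc, hu, hB.isoPullback_hom_fst_assoc]⟩
  · rintro ⟨u, hu⟩
    exact ⟨hB.isoPullback.inv ≫ u, by rw [Category.assoc, hu, hB.isoPullback_inv_fst_assoc]⟩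

/-- A derivation restricts along every monomorphism that contains its accessed part. -/
lemma exists_isRestriction {G X : C} (d : Deriv P G X) {G' : C} (m : G' ⟶ G) [Mono m]
    (hm : ∃ u, u ≫ m = d.acc) : ∃ (X' : C) (d' : Deriv P G' X'), IsRestriction m d d' := by
  induction d generalizing G' with
  | nil G => exact ⟨G', .nil G', .nil m ‹_›⟩
  | cons p hp s t ih =>
    have hB := IsPullback.of_hasPullback s.mH t.acc
    obtain ⟨hg, u, hu⟩ := (exists_factor_acc_cons_iff hp s t hB m).1 hm
    obtain ⟨H', n, s', hs⟩ := exists_isStepRestriction s m hg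
    have := hs.mono_induced
    obtain ⟨mZ, hz, hG, hH⟩ := hs.exists_mZ
    -- `H` is glued from `R` and `s.Z`: the comatch lies in `H'` by restriction, and `s.Z ∩ ACC(t)`
    -- lies in `s'.Z` because its image in `G` lies in `G'`.
    have hacc : ∃ w, w ≫ n = t.acc := by
      refine exists_factor_of_isPushout s.right n t.acc hB ⟨_, hs.comp_h⟩
        ⟨hG.lift _ u hu.symm ≫ s'.mH, ?_⟩
      rw [Category.assoc, ← hH.w, hG.lift_fst_assoc]
    obtain ⟨X', d', hd⟩ := ih n hacc
    exact ⟨X', .cons p hp s' d', .cons hp hs hd⟩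

lemma exists_isSpine {G X : C} (d : Deriv P G X) : ∃ (S : C) (s : Deriv P d.ACC S), IsSpine d s :=
  exists_isRestriction d d.acc ⟨𝟙 _, Category.id_comp _⟩

end Accessed

/-! ### Conflux and moving -/

section Move

variable {C : Type u} [Category.{v} C] [Adhesive C] {P : Set (Rule C)} {p q : Rule C}

lemma Conflux.isPullback_H' {G H G' H' : C} {s : DirectDerivation p G H}
    {t : DirectDerivation q G G'} {s' : DirectDerivation p G' H'} {t' : DirectDerivation q H H'}
    (c : Conflux s t s' t') : IsPullback c.toZs' c.toZt' s'.mH t'.mH :=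
  have : Mono c.toZs' := Adhesive.mono_of_isPushout_of_mono_left c.right_q
  Adhesive.isPullback_of_isPushout_of_mono_left c.sq_H'

/-- Local Church-Rosser: parallel independent steps have a conflux. -/
lemma exists_conflux {G H G' : C} (s : DirectDerivation p G H) (t : DirectDerivation q G G')
    (hs : ∃ f : p.L ⟶ t.Z, f ≫ t.mG = s.g) (ht : ∃ e : q.L ⟶ s.Z, e ≫ s.mG = t.g) :
    ∃ (H' : C) (s' : DirectDerivation p G' H') (t' : DirectDerivation q H H'),
      Nonempty (Conflux s t s' t') := by
  obtain ⟨f, hf⟩ := hs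
  obtain ⟨e, he⟩ := ht
  have := s.mono_mG
  have := t.mono_mG
  obtain ⟨W, a, b, hW⟩ : ∃ (W : C) (a : W ⟶ s.Z) (b : W ⟶ t.Z), IsPullback a b s.mG t.mG :=
    ⟨_, _, _, IsPullback.of_hasPullback s.mG t.mG⟩
  obtain ⟨k, hk, hk'⟩ : ∃ k : p.K ⟶ W, k ≫ a = s.z ∧ k ≫ b = p.l ≫ f :=
    ⟨hW.lift s.z (p.l ≫ f) (by rw [Category.assoc, hf, s.left.w]),
      hW.lift_fst _ _ _, hW.lift_snd _ _ _⟩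
  obtain ⟨j, hj', hj⟩ : ∃ j : q.K ⟶ W, j ≫ a = q.l ≫ e ∧ j ≫ b = t.z :=
    ⟨hW.lift (q.l ≫ e) t.z (by rw [Category.assoc, he, t.left.w]),
      hW.lift_fst _ _ _, hW.lift_snd _ _ _⟩
  have left_p : IsPushout p.l k f b := isPushout_restrict s.left hW hf hk hk'
  have left_q : IsPushout q.l j e a := isPushout_restrict t.left hW.flip he hj hj'
  have right_p := IsPushout.of_hasPushout p.r k
  have right_q := IsPushout.of_hasPushout q.r j
  set f' := pushout.inl p.r k
  set b' := pushout.inr p.r k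
  set e' := pushout.inl q.r j
  set a' := pushout.inr q.r j
  have : Mono a' := Adhesive.mono_of_isPushout_of_mono_left right_q
  have : Mono b' := Adhesive.mono_of_isPushout_of_mono_left right_p
  have sq_H' := IsPushout.of_hasPushout a' b'
  have hs_right : IsPushout p.r (k ≫ a) s.h s.mH := by rw [hk]; exact s.right
  have ht_right : IsPushout q.r (j ≫ b) t.h t.mH := by rw [hj]; exact t.right
  -- Since `s.z = k ≫ a`, the right square of `s` splits through the pushout along `k`.
  obtain ⟨n, hn, sq_H⟩ : ∃ n : pushout p.r k ⟶ H, f' ≫ n = s.h ∧ IsPushout b' a n s.mH :=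
    ⟨_, right_p.inl_desc _ _ _, IsPushout.of_top' hs_right right_p⟩
  obtain ⟨n', hn', sq_G'⟩ : ∃ n : pushout q.r j ⟶ G', e' ≫ n = t.h ∧ IsPushout a' b n t.mH :=
    ⟨_, right_q.inl_desc _ _ _, IsPushout.of_top' ht_right right_q⟩
  exact ⟨_, ⟨_, f ≫ t.mH, k ≫ a', f' ≫ pushout.inr a' b', n', pushout.inl a' b',
      left_p.paste_vert sq_G'.flip, right_p.paste_vert sq_H'.flip⟩,
    ⟨_, e ≫ s.mH, j ≫ b', e' ≫ pushout.inl a' b', n, pushout.inr a' b',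
      left_q.paste_vert sq_H.flip, right_q.paste_vert sq_H'⟩,
    ⟨{ W := W, toZs := a, toZt := b, toZs' := a', toZt' := b'
       f := f, k := k, f' := f', left_p := left_p, right_p := right_p
       e := e, j := j, e' := e', left_q := left_q, right_q := right_q
       sq_G := hW
       sq_H := (Adhesive.isPullback_of_isPushout_of_mono_left sq_H).flip
       sq_G' := Adhesive.isPullback_of_isPushout_of_mono_left sq_G'
       sq_H' := sq_H'
       s_g := hf, s_z := hk, s_h := hn, t_g := he, t_z := hj, t_h := hn'
       s'_g := rfl, s'_z := rfl, s'_h := rfl, t'_g := rfl, t'_z := rfl, t'_h := rfl }⟩⟩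

lemma exists_isMove {P' : Set (Rule C)} (hPP' : ParallelIndependent P P') (hq : q ∈ P')
    {G X G' : C} (d : Deriv P G X) (t : DirectDerivation q G G') :
    ∃ (X' : C) (d' : Deriv P G' X') (t' : DirectDerivation q X X'), IsMove d t d' t' := by
  induction d generalizing G' with
  | nil G => exact ⟨G', .nil G', t, .nil t⟩
  | cons p hp s d ih =>
    obtain ⟨hs, ht⟩ := hPP' p hp q hq _ _ _ s t
    obtain ⟨H', s', t', ⟨c⟩⟩ := exists_conflux s t hs ht
    obtain ⟨X', d', t'', h⟩ := ih t'
    exact ⟨X', .cons p hp s' d', t'', .cons hp c h⟩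

/-- A derivation and the moved derivation have a common restriction to the intermediate object. -/
lemma IsMove.exists_common_restriction {G X G' X' : C} {d : Deriv P G X}
    {t : DirectDerivation q G G'} {d' : Deriv P G' X'} {t' : DirectDerivation q X X'}
    (h : IsMove d t d' t') :
    ∃ (Y : C) (d'' : Deriv P t.Z Y), IsRestriction t.mG d d'' ∧ IsRestriction t.mH d' d'' := by
  induction h with
  | nil t => exact ⟨t.Z, .nil _, .nil _ t.mono_mG, .nil _ t.mono_mH⟩
  | @cons _ _ _ _ _ _ p hp s t s' t' d d' t'' c h ih =>
    obtain ⟨Y, d'', h₁, h₂⟩ := ih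
    refine ⟨Y, .cons p hp ⟨c.W, c.f, c.k, c.f', c.toZt, c.toZt', c.left_p, c.right_p⟩ d'',
      .cons hp ⟨t.mono_mG, c.s_g, c.s_h, c.toZs, c.s_z, c.sq_G, c.sq_H⟩ h₁,
      .cons hp ⟨t.mono_mH, c.s'_g, c.s'_h, c.toZs', c.s'_z, c.sq_G', c.isPullback_H'⟩ h₂⟩

variable [HasPullbacks C] [HasInitial C] [HasStrictInitialObjects C]
  [(MorphismProperty.epimorphisms C).HasFactorization (MorphismProperty.monomorphisms C)]

/-- The accessed parts of two derivations from the two ends of a step, if they both lie in its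
intermediate object and are contained in the same of its subobjects, agree there. -/
lemma exists_acc_iso {G X G' X' : C} {d : Deriv P G X} {t : DirectDerivation q G G'}
    {d' : Deriv P G' X'} (h₁ : ∃ u, u ≫ t.mG = d.acc)
    (h : ∀ {N : C} (k : N ⟶ t.Z) [Mono k],
      (∃ u, u ≫ k ≫ t.mG = d.acc) ↔ ∃ u, u ≫ k ≫ t.mH = d'.acc) :
    ∃ (i : d.ACC ≅ d'.ACC) (m : d.ACC ⟶ t.Z) (m' : d'.ACC ⟶ t.Z),
      Mono m ∧ Mono m' ∧ i.hom ≫ m' = m ∧ m ≫ t.mG = d.acc ∧ m' ≫ t.mH = d'.acc := by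
  have := t.mono_mG
  have := t.mono_mH
  obtain ⟨m, hm⟩ := h₁
  obtain ⟨m', hm'⟩ : ∃ u, u ≫ t.mH = d'.acc := by
    simpa using (h (𝟙 t.Z)).1 ⟨m, by simpa using hm⟩
  have hM : Mono m := by
    have : Mono (m ≫ t.mG) := by rw [hm]; infer_instance
    exact mono_of_mono m t.mG
  have hM' : Mono m' := by
    have : Mono (m' ≫ t.mH) := by rw [hm']; infer_instance
    exact mono_of_mono m' t.mH
  -- Testing the equivalence on the two accessed parts themselves gives mutually inverse
  -- comparisons.
  obtain ⟨a, ha⟩ := (h m).1 ⟨𝟙 _, by simpa using hm⟩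
  obtain ⟨b, hb⟩ := (h m').2 ⟨𝟙 _, by simpa using hm'⟩
  have ha' : a ≫ m = m' := by rw [← cancel_mono t.mH, Category.assoc, ha, hm']
  have hb' : b ≫ m' = m := by rw [← cancel_mono t.mG, Category.assoc, hb, hm]
  exact ⟨⟨b, a, by rw [← cancel_mono m]; simp [ha', hb'], by rw [← cancel_mono m']; simp [ha', hb']⟩,
    m, m', hM, hM', hb', hm, hm'⟩

/-- The accessed parts of a derivation and of the moved derivation agree in the intermediate
object. -/
lemma IsMove.exists_acc_iso {G X G' X' : C} {d : Deriv P G X}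
    {t : DirectDerivation q G G'} {d' : Deriv P G' X'} {t' : DirectDerivation q X X'}
    (h : IsMove d t d' t') :
    ∃ (i : d.ACC ≅ d'.ACC) (m : d.ACC ⟶ t.Z) (m' : d'.ACC ⟶ t.Z),
      Mono m ∧ Mono m' ∧ i.hom ≫ m' = m ∧ m ≫ t.mG = d.acc ∧ m' ≫ t.mH = d'.acc := by
  induction h with
  | nil t =>
    refine DPO.exists_acc_iso ⟨initial.to _, initialIsInitial.hom_ext _ _⟩ fun {N} k _ => ?_
    exact ⟨fun _ => ⟨initial.to N, initialIsInitial.hom_ext _ _⟩,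
      fun _ => ⟨initial.to N, initialIsInitial.hom_ext _ _⟩⟩
  | @cons _ _ _ _ _ _ p hp s t s' t' d d' t'' c h ih =>
    obtain ⟨i, m, m', hm, hm', him, hacc, hacc'⟩ := ih
    have := t.mono_mG
    have := t.mono_mH
    -- One object `W ∩ ACC(d)`, formed over `t'.Z`, serves as both `s.Z ∩ ACC(d)` over `H` and `s'.Z
    -- ∩ ACC(d')` over `H'`, by pasting with the conflux pullbacks.
    have hB := IsPullback.of_hasPullback c.toZt' m
    have hB₁ : IsPullback (pullback.fst c.toZt' m ≫ c.toZs) (pullback.snd c.toZt' m)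
        s.mH d.acc := by
      rw [← hacc]; exact (hB.paste_horiz c.sq_H)
    have hB₂ : IsPullback (pullback.fst c.toZt' m ≫ c.toZs') (pullback.snd c.toZt' m ≫ i.hom)
        s'.mH d'.acc := by
      have hi : IsPullback (pullback.fst c.toZt' m) (pullback.snd c.toZt' m ≫ i.hom)
          c.toZt' m' :=
        IsPullback.of_iso hB (Iso.refl _) (Iso.refl _) i (Iso.refl _)
          (by simp) (by simp) (by simp) (by simp [him])
      rw [← hacc']; exact (hi.paste_horiz c.isPullback_H')
    -- Both matches and both tail parts factor through `t.Z`; cancelling `t.mG` and `t.mH` leaves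
    -- the same condition on `k`.
    have key : ∀ {N : C} (k : N ⟶ t.Z) [Mono k],
        ((∃ u, u ≫ k ≫ t.mG = (Deriv.cons p hp s d).acc) ↔
          (∃ u, u ≫ k = c.f) ∧ ∃ u, u ≫ k = pullback.fst c.toZt' m ≫ c.toZt) ∧
        ((∃ u, u ≫ k ≫ t.mH = (Deriv.cons p hp s' d').acc) ↔
          (∃ u, u ≫ k = c.f) ∧ ∃ u, u ≫ k = pullback.fst c.toZt' m ≫ c.toZt) := by
      intro N k _
      rw [exists_factor_acc_cons_iff hp s d hB₁ (k ≫ t.mG),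
        exists_factor_acc_cons_iff hp s' d' hB₂ (k ≫ t.mH), ← c.s_g, ← c.s'_g]
      simp only [Category.assoc, c.sq_G.w, c.sq_G'.w]
      simp only [← Category.assoc, cancel_mono, and_self]
    refine DPO.exists_acc_iso ?_ fun k _ => (key k).1.trans (key k).2.symm
    simpa using (key (𝟙 t.Z)).1.2 ⟨⟨c.f, by simp⟩, _, Category.comp_id _⟩

end Move

end DPO

theorem mainTheorem3 {C : Type u} [Category.{v} C] [Adhesive C] [HasPullbacks C]
    [HasInitial C] [HasStrictInitialObjects C]
    [(MorphismProperty.epimorphisms C).HasFactorization (MorphismProperty.monomorphisms C)]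
    (P P' : Set (Rule C)) (hPP' : ParallelIndependent P P')
    {G X G' : C} (d : Deriv P G X)
    (q : Rule C) (hq : q ∈ P') (t : DirectDerivation q G G') :
    -- `move(d, t)` exists
    (∃ (X' : C) (d' : Deriv P G' X') (t' : DirectDerivation q X X'), IsMove d t d' t') ∧
    -- and every choice `d'` of it has the following properties
    ∀ (X' : C) (d' : Deriv P G' X') (t' : DirectDerivation q X X'), IsMove d t d' t' →
      -- `d` and `d'` have a common restriction to the intermediate object of `t`
      (∃ (Y : C) (d'' : Deriv P t.Z Y),
        IsRestriction t.mG d d'' ∧ IsRestriction t.mH d' d'') ∧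
      -- the accessed parts are isomorphic, compatibly with monomorphisms into that object
      (∃ (i : d.ACC ≅ d'.ACC) (m : d.ACC ⟶ t.Z) (m' : d'.ACC ⟶ t.Z),
        Mono m ∧ Mono m' ∧ i.hom ≫ m' = m ∧ m ≫ t.mG = d.acc ∧ m' ≫ t.mH = d'.acc) ∧
      -- the spines exist and are equal up to isomorphism
      (∃ (S : C) (s : Deriv P d.ACC S), IsSpine d s) ∧
      (∃ (S' : C) (s' : Deriv P d'.ACC S'), IsSpine d' s') ∧
      (∀ (S S' : C) (s : Deriv P d.ACC S) (s' : Deriv P d'.ACC S'),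
        IsSpine d s → IsSpine d' s' → EqUpToIso s s') := by
  refine ⟨exists_isMove hPP' hq d t, fun X' d' t' h => ?_⟩
  obtain ⟨Y, d'', h₁, h₂⟩ := h.exists_common_restriction
  obtain ⟨i, m, m', hm, hm', him, hacc, hacc'⟩ := h.exists_acc_iso
  refine ⟨⟨Y, d'', h₁, h₂⟩, ⟨i, m, m', hm, hm', him, hacc, hacc'⟩, exists_isSpine d,
    exists_isSpine d', fun S S' s s' hs hs' => ⟨i.symm, ?_⟩⟩
  have hr : IsRestriction m d'' s := IsRestriction.cancel (by rw [hacc]; exact hs) h₁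
  have hr' : IsRestriction m' d'' s' := IsRestriction.cancel (by rw [hacc']; exact hs') h₂
  -- As `m' = i.inv ≫ m`, `s'` is `d''` restricted along `i.inv ≫ m`, hence `s` restricted along
  -- `i.inv`.
  refine IsRestriction.cancel (b := m) ?_ hr
  rwa [Iso.symm_hom, ← him, i.inv_hom_id_assoc]
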